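/- Let $k,l,n\ge 0$ be integers with $l\le n$. Let $G_l(\mathbb{R}^n)$ be the Grassmann manifold of $l$-dimensional linear subspaces of $\mathbb{R}^n$, with the metric $\operatorname{dist}(\nu,\nu')=\|\mathbf{P}_\nu-\mathbf{P}_{\nu'}\|$ (operator norm of the difference of the orthogonal projections), and let $\mu$ be the normalized Haar measure on it, i.e. the unique Borel probability measure on $G_l(\mathbb{R}^n)$ that is invariant under the action of the orthogonal group $O(n)$ (the distribution of $U\nu_0$ for a Haar-distributed $U\in O(n)$ and a fixed $\nu_0\in G_l(\mathbb{R}^n)$). For $F:[0,\infty)\to[0,\infty)$, $\mathbf{z}\in\mathbb{R}^n$ and $T\subseteq\{1,\dots,n\}$ put $J_F(\mathbf{z}_T)=\sum_{i\in T}F(|z_i|)$. The exact recovery (ERC) set of $F$ is, through the null space property, $$\Omega_F=\{\nu\in G_l(\mathbb{R}^n) : J_F(\mathbf{z}_T)<J_F(\mathbf{z}_{T^c})\ \text{ for all } \mathbf{z}\in\nu\setminus\{\mathbf{0}\} \text{ and all } T\subseteq\{1,\dots,n\} \text{ with } |T|\le k\}.$$ Let $\alpha>0$, let $\Omega_{\mathrm{ZAP}}$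 be the set $\Omega_F$ for the ZAP (minimax concave penalty) sparseness measure $$F(x)=\begin{cases}2\alpha x-\alpha^2x^2, & 0\le x<1/\alpha,\\ 1, & x\ge 1/\alpha,\end{cases}$$ and let $\Omega_{\ell_1}$ be the set $\Omega_F$ for $F(x)=x$. Then $$\mu(\Omega_{\mathrm{ZAP}})=\mu(\Omega_{\ell_1}).$$ -/

import Mathlib

open MeasureTheory

/-- `ℝⁿ` with its Euclidean norm. -/
abbrev Rn (n : ℕ) : Type := EuclideanSpace ℝ (Fin n)

/-! ### The Grassmann manifold -/

/-- The Grassmann manifold `G_l(ℝⁿ)`: the `l`-dimensional linear subspaces of `ℝⁿ`. -/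
@[ext]
structure Grassmann (n l : ℕ) where
  plane : Submodule ℝ (Rn n)
  finrank_plane : Module.finrank ℝ plane = l

namespace Grassmann

/-- The orthogonal projection `P_ν` of `ℝⁿ` onto `ν`. -/
noncomputable def proj {n l : ℕ} (ν : Grassmann n l) : Rn n →L[ℝ] Rn n :=
  ν.plane.starProjection

theorem proj_injective {n l : ℕ} :
    Function.Injective (proj : Grassmann n l → Rn n →L[ℝ] Rn n) := by
  intro ν ν' h
  apply Grassmann.ext
  exact Submodule.starProjection_inj.1 h

/-- The metric `dist ν ν' = ‖P_ν - P_ν'‖`, with the operator norm. -/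
noncomputable instance instMetric (n l : ℕ) : MetricSpace (Grassmann n l) :=
  MetricSpace.induced proj proj_injective inferInstance

theorem dist_eq {n l : ℕ} (ν ν' : Grassmann n l) : dist ν ν' = ‖proj ν - proj ν'‖ :=
  dist_eq_norm (proj ν) (proj ν')

/-- The Borel σ-algebra of the metric topology. -/
noncomputable instance instMeasurable (n l : ℕ) : MeasurableSpace (Grassmann n l) :=
  borel (Grassmann n l)

instance instBorel (n l : ℕ) : BorelSpace (Grassmann n l) := ⟨rfl⟩

end Grassmann

/-! ### The orthogonal group and its normalized Haar measure -/

/-- The Borel σ-algebra of the orthogonal group `O(n)` (with the topology of `ℝ^(n × n)`). -/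
noncomputable instance instMeasurableOrthogonal (n : ℕ) :
    MeasurableSpace (Matrix.orthogonalGroup (Fin n) ℝ) :=
  borel (Matrix.orthogonalGroup (Fin n) ℝ)

instance instBorelOrthogonal (n : ℕ) : BorelSpace (Matrix.orthogonalGroup (Fin n) ℝ) := ⟨rfl⟩

instance instCompactOrthogonal (n : ℕ) : CompactSpace (Matrix.orthogonalGroup (Fin n) ℝ) := by
  refine isCompact_iff_compactSpace.1 ?_
  have hK : IsCompact (Set.pi Set.univ fun _ : Fin n => Set.pi Set.univ
      fun _ : Fin n => Set.Icc (-1 : ℝ) 1) :=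
    isCompact_univ_pi fun _ => isCompact_univ_pi fun _ => isCompact_Icc
  refine hK.of_isClosed_subset (isClosed_unitary (R := Matrix (Fin n) (Fin n) ℝ)) ?_
  intro U hU i _ j _
  exact abs_le.1 (entry_norm_bound_of_unitary (𝕜 := ℝ) hU i j)

/-- The Haar measure on the compact group `O(n)` of total mass one. -/
noncomputable def orthogonalHaar (n : ℕ) : Measure (Matrix.orthogonalGroup (Fin n) ℝ) :=
  Measure.haarMeasure ⊤

/-! ### The action of the orthogonal group and the invariant measure -/

namespace Grassmann

/-- Left multiplication by an orthogonal matrix, `ν ↦ U ν = {U z | z ∈ ν}`. -/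
noncomputable def rotate {n l : ℕ} (U : Matrix.orthogonalGroup (Fin n) ℝ) (ν : Grassmann n l) :
    Grassmann n l :=
  ⟨ν.plane.map (Matrix.toEuclideanLin U.1), by
    have hinj : Function.Injective (Matrix.toEuclideanLin U.1) := by
      intro x y h
      have h' := congrArg (fun v => Matrix.toEuclideanLin (star U.1) v) h
      have key : ∀ v : Rn n,
          Matrix.toEuclideanLin (star U.1) (Matrix.toEuclideanLin U.1 v) = v := by
        intro v
        simp [Matrix.toLpLin_apply, Matrix.mulVec_mulVec, Unitary.star_mul_self_of_mem U.2]
      simpa only [key] using h'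
    exact (LinearEquiv.finrank_eq (Submodule.equivMapOfInjective _ hinj ν.plane)).symm.trans
      ν.finrank_plane⟩

/-- The `l`-plane spanned by the first `l` standard basis vectors of `ℝⁿ`. -/
noncomputable def basePlane {n l : ℕ} (h : l ≤ n) : Grassmann n l :=
  ⟨Submodule.span ℝ (Set.range fun i : Fin l => EuclideanSpace.basisFun (Fin n) ℝ (Fin.castLE h i)),
    by
      have hli : LinearIndependent ℝ
          (fun i : Fin l => EuclideanSpace.basisFun (Fin n) ℝ (Fin.castLE h i)) :=
        (EuclideanSpace.basisFun (Fin n) ℝ).orthonormal.linearIndependent.comp _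
          (Fin.castLE_injective h)
      rw [finrank_span_eq_card hli, Fintype.card_fin]⟩

/-- The normalized Haar measure `μ` on `G_l(ℝⁿ)`: the distribution of `U ν₀`, where `U` is a Haar
distributed orthogonal matrix and `ν₀` a fixed `l`-plane. -/
noncomputable def haar {n l : ℕ} (h : l ≤ n) : Measure (Grassmann n l) :=
  (orthogonalHaar n).map fun U => rotate U (basePlane h)

theorem rotate_mul {n l : ℕ} (U V : Matrix.orthogonalGroup (Fin n) ℝ) (ν : Grassmann n l) :
    rotate (U * V) ν = rotate U (rotate V ν) := by
  apply Grassmann.ext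
  change ν.plane.map (Matrix.toEuclideanLin (U.1 * V.1)) = _
  have h : Matrix.toEuclideanLin (U.1 * V.1) =
      (Matrix.toEuclideanLin U.1).comp (Matrix.toEuclideanLin V.1) := by
    ext x
    simp [Matrix.toLpLin_apply, Matrix.mulVec_mulVec]
  rw [h, Submodule.map_comp]
  rfl

theorem proj_rotate {n l : ℕ} (U : Matrix.orthogonalGroup (Fin n) ℝ) (ν : Grassmann n l) :
    proj (rotate U ν) = Matrix.toEuclideanCLM (𝕜 := ℝ) U.1 * proj ν *
      Matrix.toEuclideanCLM (𝕜 := ℝ) (star U.1) := by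
  set A := Matrix.toEuclideanCLM (n := Fin n) (𝕜 := ℝ) with hA
  have hmem : A U.1 ∈ unitary (Rn n →L[ℝ] Rn n) := by
    rw [Unitary.mem_iff, ← map_star, ← map_mul, ← map_mul,
      Unitary.star_mul_self_of_mem U.2, Unitary.mul_star_self_of_mem U.2, map_one]
    exact ⟨rfl, rfl⟩
  ext1 x
  have h := Submodule.starProjection_map_apply
    (Unitary.linearIsometryEquiv (⟨A U.1, hmem⟩ : unitary (Rn n →L[ℝ] Rn n))) ν.plane x
  rw [map_star]
  exact h

theorem continuous_toEuclideanCLM (n : ℕ) : Continuous fun M : Matrix (Fin n) (Fin n) ℝ =>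
    Matrix.toEuclideanCLM (n := Fin n) (𝕜 := ℝ) M :=
  LinearMap.continuous_of_finiteDimensional
    (Matrix.toEuclideanCLM (n := Fin n) (𝕜 := ℝ)).toAlgEquiv.toLinearMap

/-- The orbit maps are continuous, hence measurable, so that `haar` is a genuine image measure. -/
theorem continuous_rotate {n l : ℕ} (ν : Grassmann n l) :
    Continuous fun U : Matrix.orthogonalGroup (Fin n) ℝ => rotate U ν := by
  refine continuous_induced_rng.2 ?_
  have h : (proj ∘ fun U : Matrix.orthogonalGroup (Fin n) ℝ => rotate U ν) = fun U =>
      Matrix.toEuclideanCLM (𝕜 := ℝ) U.1 * proj ν * Matrix.toEuclideanCLM (𝕜 := ℝ) (star U.1) :=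
    funext fun U => proj_rotate U ν
  rw [h]
  exact (((continuous_toEuclideanCLM n).comp continuous_subtype_val).mul continuous_const).mul
    ((continuous_toEuclideanCLM n).comp (continuous_star.comp continuous_subtype_val))

theorem continuous_rotate_right {n l : ℕ} (U : Matrix.orthogonalGroup (Fin n) ℝ) :
    Continuous (rotate U : Grassmann n l → Grassmann n l) := by
  refine continuous_induced_rng.2 ?_
  have h : (proj ∘ (rotate U : Grassmann n l → Grassmann n l)) = fun ν =>
      Matrix.toEuclideanCLM (𝕜 := ℝ) U.1 * proj ν * Matrix.toEuclideanCLM (𝕜 := ℝ) (star U.1) :=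
    funext fun ν => proj_rotate U ν
  rw [h]
  have hp : Continuous (proj : Grassmann n l → Rn n →L[ℝ] Rn n) := continuous_induced_dom
  exact (continuous_const.mul hp).mul continuous_const

/-- `μ` has total mass one. -/
instance isProbabilityMeasure_haar {n l : ℕ} (h : l ≤ n) : IsProbabilityMeasure (haar h) := by
  have : IsProbabilityMeasure (orthogonalHaar n) :=
    ⟨Measure.haarMeasure_self (K₀ := (⊤ : TopologicalSpace.PositiveCompacts _))⟩
  exact Measure.isProbabilityMeasure_map (continuous_rotate _).measurable.aemeasurable

/-- `μ` is invariant under the action of the orthogonal group. -/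
theorem map_rotate_haar {n l : ℕ} (h : l ≤ n) (U : Matrix.orthogonalGroup (Fin n) ℝ) :
    (haar h).map (rotate U) = haar h := by
  have hinv : (orthogonalHaar n).map (fun V => U * V) = orthogonalHaar n :=
    Measure.IsMulLeftInvariant.map_mul_left_eq_self (μ := Measure.haarMeasure
      (⊤ : TopologicalSpace.PositiveCompacts (Matrix.orthogonalGroup (Fin n) ℝ))) U
  rw [haar, Measure.map_map (continuous_rotate_right U).measurable
    (continuous_rotate _).measurable]
  conv_rhs => rw [← hinv]
  rw [Measure.map_map (continuous_rotate _).measurable (continuous_const_mul U).measurable]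
  congr 1
  funext V
  exact (rotate_mul U V _).symm

end Grassmann

/-! ### Cost functions and exact recovery sets -/

/-- `J(x_T) = ∑_{i ∈ T} F(|x_i|)`, for `F` a function on `[0, ∞)`. -/
def costOn {n : ℕ} (F : ℝ → ℝ) (T : Finset (Fin n)) (x : Rn n) : ℝ :=
  ∑ i ∈ T, F |x i|

/-- The exact recovery set `Ω_J(n, k, l)`, given by the null space property: the `ν ∈ G_l(ℝⁿ)` with
`J(z_T) < J(z_{Tᶜ})` for all nonzero `z ∈ ν` and all `T` with at most `k` elements. -/
def ercSet (F : ℝ → ℝ) (n k l : ℕ) : Set (Grassmann n l) :=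
  {ν | ∀ z ∈ ν.plane, z ≠ 0 → ∀ T : Finset (Fin n), T.card ≤ k → costOn F T z < costOn F Tᶜ z}

/-- The ZAP (minimax concave penalty) sparseness measure with tuning parameter `α`, on `[0, ∞)`. -/
noncomputable def zapF (α x : ℝ) : ℝ :=
  if x < 1 / α then 2 * α * x - α ^ 2 * x ^ 2 else 1

/-- The `ℓ₁` sparseness measure `F(x) = x` on `[0, ∞)`. -/
def l1F (x : ℝ) : ℝ := x

/-! ### The recovery set of the ZAP penalty contains that of the `ℓ₁` norm -/

/-! The ℓ₁ recovery set lies in the ZAP one because F is nondecreasing and F(x)/x nonincreasing: it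
suffices to test the set S of largest entries, and the ratio at the smallest entry of S compares
both sides with ℓ₁ (`ercSet_l1F_subset_ercSet_zapF`). Conversely F(tx)/(2αt) → x as t → 0+, so a ZAP
plane satisfies the ℓ₁ inequalities weakly, and the two sets differ only by planes with a tie.

Such planes are null (`haar_setOf_isTight`). Scaling the coordinates in T by e^t multiplies one side
of the inequality and fixes the other, so at most one t gives a tie. Fubini turns this into a
Lebesgue-null statement about invertible operators. A second Fubini, over O(n) times the operators,
finds one invertible B such that U B ν₀ is tie-free for almost every U; since B ν₀ = V ν₀ with V
orthogonal, right invariance of Haar measure removes V. -/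

section Penalty

variable {α : ℝ}

theorem zapF_eq_one_sub (x : ℝ) : zapF α x = if x < 1 / α then 1 - (1 - α * x) ^ 2 else 1 := by
  unfold zapF
  split_ifs
  · ring
  · rfl

theorem zapF_zero (hα : 0 < α) : zapF α 0 = 0 := by
  simp [zapF, hα]

theorem zapF_pos (hα : 0 < α) {x : ℝ} (hx : 0 < x) : 0 < zapF α x := by
  unfold zapF
  split_ifs with h
  · rw [lt_div_iff₀ hα] at h
    have : 0 < α * x := by positivity
    nlinarith
  · exact one_pos

theorem zapF_nonneg (hα : 0 < α) {x : ℝ} (hx : 0 ≤ x) : 0 ≤ zapF α x := by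
  rcases hx.eq_or_lt with rfl | h
  · exact (zapF_zero hα).ge
  · exact (zapF_pos hα h).le

theorem zapF_mono (hα : 0 < α) {x y : ℝ} (hxy : x ≤ y) : zapF α x ≤ zapF α y := by
  rw [zapF_eq_one_sub, zapF_eq_one_sub]
  split_ifs with h h' h'
  · rw [lt_div_iff₀ hα] at h h'
    have : α * x ≤ α * y := by gcongr
    nlinarith
  · nlinarith [sq_nonneg (1 - α * x)]
  · exact absurd (hxy.trans_lt h') h
  · exact le_rfl

/-- The ratio `F(x) / x` is nonincreasing, in cross-multiplied form. -/
theorem zapF_mul_le (hα : 0 < α) {x y : ℝ} (hx : 0 ≤ x) (hxy : x ≤ y) :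
    zapF α y * x ≤ zapF α x * y := by
  unfold zapF
  split_ifs with h h' h'
  · have : 0 ≤ α ^ 2 * (x * y) * (y - x) :=
      mul_nonneg (mul_nonneg (sq_nonneg α) (mul_nonneg hx (hx.trans hxy))) (sub_nonneg.2 hxy)
    nlinarith
  · exact absurd (hxy.trans_lt h) h'
  · rw [lt_div_iff₀ hα] at h'
    rw [not_lt, div_le_iff₀ hα] at h
    have h2 : 2 * α * x - α ^ 2 * x ^ 2 = (α * x) * (2 - α * x) := by ring
    have h3 : 0 ≤ α * x := by positivity
    have h4 : x * 1 ≤ x * (α * y * (2 - α * x)) := by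
      apply mul_le_mul_of_nonneg_left _ hx
      nlinarith
    rw [h2]; nlinarith
  · linarith

end Penalty

/-- Among the finite sets with a given number of elements there is one that carries the largest
values of `f`. -/
theorem exists_card_eq_forall_notMem_le {ι : Type*} [Fintype ι] [DecidableEq ι] (f : ι → ℝ)
    (T : Finset ι) : ∃ S : Finset ι, S.card = T.card ∧ ∀ i ∈ S, ∀ j ∉ S, f j ≤ f i := by
  obtain ⟨S, hS, hmax⟩ := Finset.exists_max_image (Finset.univ.powersetCard T.card)
    (fun S => ∑ i ∈ S, f i) ⟨T, by simp⟩
  rw [Finset.mem_powersetCard_univ] at hS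
  refine ⟨S, hS, fun i hi j hj => ?_⟩
  have hj' : j ∉ S.erase i := fun h => hj (Finset.mem_of_mem_erase h)
  -- Exchanging i for j cannot increase the maximal sum.
  have h := hmax (insert j (S.erase i)) (by
    rw [Finset.mem_powersetCard_univ, Finset.card_insert_of_notMem hj', Finset.card_erase_of_mem hi,
      ← hS, Nat.sub_add_cancel (Finset.card_pos.2 ⟨i, hi⟩)])
  rw [Finset.sum_insert hj', ← Finset.add_sum_erase S f hi] at h
  linarith

/-- Once S ∩ T is cancelled, the two differences have equal size, and the least value on S \ T
separates them. -/
theorem sum_le_sum_of_forall_notMem_le {ι : Type*} [DecidableEq ι] {f : ι → ℝ} {S T : Finset ι}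
    (hcard : S.card = T.card) (h : ∀ i ∈ S, ∀ j ∉ S, f j ≤ f i) :
    ∑ i ∈ T, f i ≤ ∑ i ∈ S, f i := by
  rw [← Finset.sum_sdiff_le_sum_sdiff]
  have hc : (T \ S).card = (S \ T).card := Finset.card_sdiff_comm hcard.symm
  rcases (S \ T).eq_empty_or_nonempty with he | hne
  · rw [he, Finset.card_empty, Finset.card_eq_zero] at hc
    rw [he, hc]
  · obtain ⟨m, hm, hmin⟩ := Finset.exists_min_image (S \ T) f hne
    calc ∑ i ∈ T \ S, f i ≤ (T \ S).card • f m :=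
          Finset.sum_le_card_nsmul _ _ _ fun j hj =>
            h m (Finset.mem_sdiff.1 hm).1 j (Finset.mem_sdiff.1 hj).2
      _ = (S \ T).card • f m := by rw [hc]
      _ ≤ ∑ i ∈ S \ T, f i := Finset.card_nsmul_le_sum _ _ _ hmin

theorem costOn_add_costOn_compl {n : ℕ} (F : ℝ → ℝ) (T : Finset (Fin n)) (x : Rn n) :
    costOn F T x + costOn F Tᶜ x = ∑ i, F |x i| :=
  Finset.sum_add_sum_compl T _

theorem costOn_l1F_nonneg {n : ℕ} (T : Finset (Fin n)) (x : Rn n) : 0 ≤ costOn l1F T x :=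
  Finset.sum_nonneg fun i _ => abs_nonneg (x i)

theorem ercSet_l1F_subset_ercSet_zapF (n k l : ℕ) {α : ℝ} (hα : 0 < α) :
    ercSet l1F n k l ⊆ ercSet (zapF α) n k l := by
  intro ν hν z hz hz0 T hT
  obtain ⟨S, hcard, hS⟩ := exists_card_eq_forall_notMem_le (fun i => |z i|) T
  have hlt : costOn l1F S z < costOn l1F Sᶜ z := hν z hz hz0 S (hcard.trans_le hT)
  have hTS : costOn (zapF α) T z ≤ costOn (zapF α) S z :=
    sum_le_sum_of_forall_notMem_le hcard fun i hi j hj => zapF_mono hα (hS i hi j hj)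
  -- The total cost is fixed, so a larger cost on S means a smaller one on its complement.
  suffices h : costOn (zapF α) S z < costOn (zapF α) Sᶜ z by
    have h1 := costOn_add_costOn_compl (zapF α) T z
    have h2 := costOn_add_costOn_compl (zapF α) S z
    linarith
  have hpos : 0 < costOn l1F Sᶜ z := (costOn_l1F_nonneg S z).trans_lt hlt
  -- A nonzero entry outside S settles empty S, and otherwise makes the least entry of S positive.
  obtain ⟨j, hj, hjpos⟩ : ∃ j ∈ Sᶜ, 0 < |z j| := by
    by_contra! hcon
    exact hpos.not_ge (Finset.sum_nonpos hcon)
  rcases S.eq_empty_or_nonempty with rfl | hne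
  · rw [costOn, Finset.sum_empty]
    exact Finset.sum_pos' (fun i _ => zapF_nonneg hα (abs_nonneg _)) ⟨j, hj, zapF_pos hα hjpos⟩
  · obtain ⟨m, hm, hmin⟩ := Finset.exists_min_image S (fun i => |z i|) hne
    have hmpos : 0 < |z m| := hjpos.trans_le (hS m hm j (Finset.mem_compl.1 hj))
    have hF := zapF_pos hα hmpos
    have h1 : costOn (zapF α) S z * |z m| ≤ zapF α |z m| * costOn l1F S z := by
      simp only [costOn, Finset.sum_mul, Finset.mul_sum]
      exact Finset.sum_le_sum fun i hi => zapF_mul_le hα hmpos.le (hmin i hi)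
    have h2 : zapF α |z m| * costOn l1F Sᶜ z ≤ costOn (zapF α) Sᶜ z * |z m| := by
      simp only [costOn, Finset.sum_mul, Finset.mul_sum]
      exact Finset.sum_le_sum fun i hi =>
        zapF_mul_le hα (abs_nonneg _) (hS m hm i (Finset.mem_compl.1 hi))
    exact lt_of_mul_lt_mul_right
      (h1.trans_lt ((mul_lt_mul_of_pos_left hlt hF).trans_le h2)) hmpos.le

/-! ### Planes with a tie -/

/-- The `ℓ₁` null space inequality for `T` holds on `S` in its weak form, with equality at some
nonzero vector. -/
def IsTight {n : ℕ} (T : Finset (Fin n)) (S : Submodule ℝ (Rn n)) : Prop :=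
  (∀ z ∈ S, costOn l1F T z ≤ costOn l1F Tᶜ z) ∧
    ∃ z ∈ S, z ≠ 0 ∧ costOn l1F T z = costOn l1F Tᶜ z

open Filter Topology in
-- A plane contains t z for every t. For small t > 0 only the quadratic branch of F occurs; dividing
-- by α t and letting t → 0 leaves the linear term, at the price of strictness.
theorem costOn_l1F_le_of_mem_ercSet_zapF {n k l : ℕ} {α : ℝ} (hα : 0 < α) {ν : Grassmann n l}
    (hν : ν ∈ ercSet (zapF α) n k l) {T : Finset (Fin n)} (hT : T.card ≤ k) {z : Rn n}
    (hz : z ∈ ν.plane) : costOn l1F T z ≤ costOn l1F Tᶜ z := by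
  rcases eq_or_ne z 0 with rfl | hz0
  · simp [costOn, l1F]
  let Q (R : Finset (Fin n)) : ℝ := ∑ i ∈ R, |z i| ^ 2
  have hsmall : ∀ᶠ t in 𝓝[>] (0 : ℝ), ∀ i, t * |z i| < 1 / α := by
    rw [eventually_all]
    intro i
    have hc : Tendsto (fun t : ℝ => t * |z i|) (𝓝[>] 0) (𝓝 (0 * |z i|)) :=
      (Continuous.tendsto (by fun_prop) 0).mono_left nhdsWithin_le_nhds
    rw [zero_mul] at hc
    exact hc.eventually_lt_const (by positivity)
  have key : ∀ᶠ t in 𝓝[>] (0 : ℝ), 2 * costOn l1F T z - α * t * Q T ≤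
      2 * costOn l1F Tᶜ z - α * t * Q Tᶜ := by
    filter_upwards [hsmall, self_mem_nhdsWithin] with t ht ht0
    have ht0 : 0 < t := ht0
    have hval : ∀ R : Finset (Fin n), costOn (zapF α) R (t • z) =
        α * t * (2 * costOn l1F R z - α * t * Q R) := by
      intro R
      simp only [costOn, Q, l1F, Finset.mul_sum, ← Finset.sum_sub_distrib]
      refine Finset.sum_congr rfl fun i _ => ?_
      have : |(t • z) i| = t * |z i| := by simp [abs_mul, abs_of_pos ht0]
      rw [this, zapF, if_pos (ht i)]
      ring
    have h := hν (t • z) (ν.plane.smul_mem t hz) (smul_ne_zero ht0.ne' hz0) T hT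
    rw [hval, hval] at h
    exact (lt_of_mul_lt_mul_left h (by positivity)).le
  have hlim : ∀ R : Finset (Fin n), Tendsto (fun t : ℝ => 2 * costOn l1F R z - α * t * Q R)
      (𝓝[>] 0) (𝓝 (2 * costOn l1F R z - α * 0 * Q R)) := fun R =>
    (Continuous.tendsto (by fun_prop) 0).mono_left nhdsWithin_le_nhds
  have := le_of_tendsto_of_tendsto (hlim T) (hlim Tᶜ) key
  linarith

theorem ercSet_zapF_diff_subset (n k l : ℕ) {α : ℝ} (hα : 0 < α) :
    ercSet (zapF α) n k l \ ercSet l1F n k l ⊆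
      ⋃ T : Finset (Fin n), {ν : Grassmann n l | IsTight T ν.plane} := by
  rintro ν ⟨hν, hν'⟩
  simp only [ercSet, Set.mem_ofPred_eq, not_forall, not_lt] at hν'
  obtain ⟨z, hz, hz0, T, hT, hle⟩ := hν'
  exact Set.mem_iUnion.2 ⟨T, ⟨fun w hw => costOn_l1F_le_of_mem_ercSet_zapF hα hν hT hw,
    z, hz, hz0, (costOn_l1F_le_of_mem_ercSet_zapF hα hν hT hz).antisymm hle⟩⟩

/-! ### Linear images of a fixed plane with a tie -/

/-- The operators that map the plane `S` onto a plane with a tie for `T`. -/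
def tightOps {n : ℕ} (T : Finset (Fin n)) (S : Submodule ℝ (Rn n)) : Set (Rn n →L[ℝ] Rn n) :=
  {A | (∀ z ∈ S, costOn l1F T (A z) ≤ costOn l1F Tᶜ (A z)) ∧
    ∃ z ∈ S, z ≠ 0 ∧ costOn l1F T (A z) = costOn l1F Tᶜ (A z)}

/-- In `tightOps` it is z, not A z, that must be nonzero; this keeps the set closed and changes
nothing for injective A. -/
theorem mem_tightOps_iff_isTight {n : ℕ} {T : Finset (Fin n)} {S : Submodule ℝ (Rn n)}
    {A : Rn n →L[ℝ] Rn n} (hA : Function.Injective A) :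
    A ∈ tightOps T S ↔ IsTight T (S.map (A : Rn n →ₗ[ℝ] Rn n)) := by
  have h0 : ∀ z, A z ≠ 0 ↔ z ≠ 0 := fun z => (map_ne_zero_iff A hA)
  simp [tightOps, IsTight, h0]

theorem costOn_l1F_smul {n : ℕ} (T : Finset (Fin n)) (c : ℝ) (x : Rn n) :
    costOn l1F T (c • x) = |c| * costOn l1F T x := by
  simp [costOn, l1F, abs_mul, Finset.mul_sum]

theorem continuous_costOn_l1F {n : ℕ} (T : Finset (Fin n)) :
    Continuous fun x : Rn n => costOn l1F T x := by
  unfold costOn l1F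
  fun_prop

/-- By homogeneity the vector with equality may be taken on the unit sphere of S, and projection
along a compact factor is closed. -/
theorem isClosed_tightOps {n : ℕ} (T : Finset (Fin n)) (S : Submodule ℝ (Rn n)) :
    IsClosed (tightOps T S) := by
  have hcont (R : Finset (Fin n)) (z : Rn n) :
      Continuous fun A : Rn n →L[ℝ] Rn n => costOn l1F R (A z) :=
    (continuous_costOn_l1F R).comp (by fun_prop)
  have hK : CompactSpace ↥((S : Set (Rn n)) ∩ Metric.sphere 0 1) :=
    isCompact_iff_compactSpace.1
      ((isCompact_sphere 0 1).inter_left S.closed_of_finiteDimensional)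
  have h2 : IsClosed (Prod.fst '' {p : (Rn n →L[ℝ] Rn n) × ↥((S : Set (Rn n)) ∩ Metric.sphere 0 1) |
      costOn l1F T (p.1 p.2) = costOn l1F Tᶜ (p.1 p.2)}) := by
    refine isClosedMap_fst_of_compactSpace _ (isClosed_eq ?_ ?_)
    · exact (continuous_costOn_l1F T).comp (by fun_prop)
    · exact (continuous_costOn_l1F Tᶜ).comp (by fun_prop)
  have h1 : IsClosed {A : Rn n →L[ℝ] Rn n |
      ∀ z ∈ S, costOn l1F T (A z) ≤ costOn l1F Tᶜ (A z)} := by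
    simp only [Set.ofPred_forall]
    exact isClosed_iInter fun z => isClosed_iInter fun _ => isClosed_le (hcont T z) (hcont Tᶜ z)
  convert h1.inter h2 using 1
  ext A
  refine and_congr Iff.rfl ⟨?_, ?_⟩
  · rintro ⟨z, hz, hz0, h⟩
    refine ⟨(A, ⟨‖z‖⁻¹ • z, S.smul_mem _ hz, ?_⟩), ?_, rfl⟩
    · simp [norm_smul, hz0]
    · simp [costOn_l1F_smul, h]
  · rintro ⟨⟨A, z, hz, hz1⟩, h, rfl⟩
    refine ⟨z, hz, ?_, h⟩
    rintro rfl
    simp at hz1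

theorem ContinuousLinearMap.injective_of_isUnit {E : Type*} [NormedAddCommGroup E]
    [NormedSpace ℝ E] {A : E →L[ℝ] E} (hA : IsUnit A) : Function.Injective A := by
  obtain ⟨u, rfl⟩ := hA
  refine Function.LeftInverse.injective (g := (↑u⁻¹ : E →L[ℝ] E)) fun x => ?_
  exact congrArg (fun B : E →L[ℝ] E => B x) u.inv_mul

/-- The diagonal operator that scales the coordinates in `T` by `e ^ t`. -/
noncomputable def scaleOn {n : ℕ} (T : Finset (Fin n)) (t : ℝ) : Rn n →L[ℝ] Rn n :=
  Matrix.toEuclideanCLM (𝕜 := ℝ) (Matrix.diagonal fun i => if i ∈ T then Real.exp t else 1)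

theorem scaleOn_apply {n : ℕ} (T : Finset (Fin n)) (t : ℝ) (x : Rn n) (i : Fin n) :
    scaleOn T t x i = (if i ∈ T then Real.exp t else 1) * x i := by
  simp [scaleOn, Matrix.mulVec_diagonal]

theorem scaleOn_mul_scaleOn_neg {n : ℕ} (T : Finset (Fin n)) (t : ℝ) :
    scaleOn T t * scaleOn T (-t) = 1 := by
  ext x i
  by_cases h : i ∈ T <;> simp [scaleOn_apply, h, ← mul_assoc, ← Real.exp_add]

theorem continuous_scaleOn {n : ℕ} (T : Finset (Fin n)) : Continuous (scaleOn T) := by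
  refine (Grassmann.continuous_toEuclideanCLM n).comp (Continuous.matrix_diagonal ?_)
  refine continuous_pi fun i => ?_
  split_ifs <;> fun_prop

theorem isUnit_scaleOn {n : ℕ} (T : Finset (Fin n)) (t : ℝ) : IsUnit (scaleOn T t) :=
  ⟨⟨scaleOn T t, scaleOn T (-t), scaleOn_mul_scaleOn_neg T t, by
    simpa using scaleOn_mul_scaleOn_neg T (-t)⟩, rfl⟩

theorem costOn_scaleOn {n : ℕ} (T : Finset (Fin n)) (t : ℝ) (x : Rn n) :
    costOn l1F T (scaleOn T t x) = Real.exp t * costOn l1F T x := by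
  rw [costOn, costOn, Finset.mul_sum]
  refine Finset.sum_congr rfl fun i hi => ?_
  simp [l1F, scaleOn_apply, hi, abs_mul]

theorem costOn_compl_scaleOn {n : ℕ} (T : Finset (Fin n)) (t : ℝ) (x : Rn n) :
    costOn l1F Tᶜ (scaleOn T t x) = costOn l1F Tᶜ x := by
  refine Finset.sum_congr rfl fun i hi => ?_
  simp [l1F, scaleOn_apply, Finset.mem_compl.1 hi]

theorem costOn_l1F_pos_of_eq {n : ℕ} {T : Finset (Fin n)} {x : Rn n} (hx : x ≠ 0)
    (h : costOn l1F T x = costOn l1F Tᶜ x) : 0 < costOn l1F T x := by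
  refine (costOn_l1F_nonneg T x).lt_of_ne fun h0 => hx ?_
  have hsum := costOn_add_costOn_compl l1F T x
  rw [← h, ← h0, add_zero, eq_comm] at hsum
  have hsum := (Finset.sum_eq_zero_iff_of_nonneg fun i _ => abs_nonneg (x i)).1 hsum
  ext i
  exact abs_eq_zero.1 (hsum i (Finset.mem_univ i))

/-- Scaling the coordinates in `T` breaks ties: at most one scaling of a given operator has one. -/
theorem subsingleton_setOf_scaleOn_mul_mem_tightOps {n : ℕ} (T : Finset (Fin n))
    (S : Submodule ℝ (Rn n)) {A : Rn n →L[ℝ] Rn n} (hA : Function.Injective A) :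
    {t : ℝ | scaleOn T t * A ∈ tightOps T S}.Subsingleton := by
  have key : ∀ s t : ℝ, scaleOn T s * A ∈ tightOps T S → scaleOn T t * A ∈ tightOps T S →
      t ≤ s := by
    -- The weak inequality at t, tested on the vector with equality at s, reads e^t c ≤ e^s c with c
    -- > 0.
    rintro s t ⟨-, z, hz, hz0, heq⟩ ⟨hle, -⟩
    have hle : costOn l1F T (scaleOn T t (A z)) ≤ costOn l1F Tᶜ (scaleOn T t (A z)) := hle z hz
    have heq : costOn l1F T (scaleOn T s (A z)) = costOn l1F Tᶜ (scaleOn T s (A z)) := heq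
    have hz' : scaleOn T s (A z) ≠ 0 := (map_ne_zero_iff _
      (ContinuousLinearMap.injective_of_isUnit (isUnit_scaleOn T s))).2
        ((map_ne_zero_iff A hA).2 hz0)
    have hpos := costOn_l1F_pos_of_eq hz' heq
    rw [costOn_scaleOn] at hpos
    rw [costOn_scaleOn, costOn_compl_scaleOn] at heq hle
    rw [← heq] at hle
    exact Real.exp_le_exp.1
      (le_of_mul_le_mul_right hle (pos_of_mul_pos_right hpos (Real.exp_pos s).le))
  exact fun s hs t ht => (key t s ht hs).antisymm (key s t hs ht)

/-! ### Null sets of operators -/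

/-- A property that holds almost everywhere in a finite-dimensional algebra holds almost everywhere
after left multiplication by a unit. -/
theorem ae_mul_left_of_isUnit {R : Type*} [NormedRing R] [NormedAlgebra ℝ R]
    [FiniteDimensional ℝ R] [MeasurableSpace R] [BorelSpace R] (m : Measure R) [m.IsAddHaarMeasure]
    {g : R} (hg : IsUnit g) {p : R → Prop} (h : ∀ᵐ a ∂m, p a) : ∀ᵐ a ∂m, p (g * a) := by
  have hdet : LinearMap.det (LinearMap.mulLeft ℝ g) ≠ 0 := by
    have : IsUnit (LinearMap.mulLeft ℝ g) := hg.map (Algebra.lmul ℝ R)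
    exact (this.map LinearMap.det).ne_zero
  rw [ae_iff] at h ⊢
  have := Measure.addHaar_preimage_linearMap m hdet {a | ¬ p a}
  rw [h, mul_zero] at this
  exact this

section Operators

variable {n : ℕ} [MeasurableSpace (Rn n →L[ℝ] Rn n)] [BorelSpace (Rn n →L[ℝ] Rn n)]

theorem measurableSet_setOf_isUnit_imp_notMem {X : Type*} [TopologicalSpace X] [MeasurableSpace X]
    [BorelSpace X] {f : X → Rn n →L[ℝ] Rn n} (hf : Continuous f) {Z : Set (Rn n →L[ℝ] Rn n)}
    (hZ : IsClosed Z) :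
    MeasurableSet {q : X × (Rn n →L[ℝ] Rn n) | IsUnit q.2 → f q.1 * q.2 ∉ Z} := by
  have h1 : IsClosed {q : X × (Rn n →L[ℝ] Rn n) | ¬ IsUnit q.2} :=
    (Units.isOpen (R := Rn n →L[ℝ] Rn n)).isClosed_compl.preimage continuous_snd
  have h2 : IsOpen {q : X × (Rn n →L[ℝ] Rn n) | f q.1 * q.2 ∉ Z} :=
    hZ.isOpen_compl.preimage ((hf.comp continuous_fst).mul continuous_snd)
  simp only [imp_iff_not_or]
  exact h1.measurableSet.union h2.measurableSet

/-- For each invertible A almost every t avoids ties, so by Fubini some single t works for almost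
every A. Multiplication by the inverse scaling preserves null sets and undoes it. -/
theorem ae_isUnit_imp_notMem_tightOps (m : Measure (Rn n →L[ℝ] Rn n)) [m.IsAddHaarMeasure]
    (T : Finset (Fin n)) (S : Submodule ℝ (Rn n)) : ∀ᵐ A ∂m, IsUnit A → A ∉ tightOps T S := by
  have h : ∀ᵐ A ∂m, ∀ᵐ t : ℝ, IsUnit A → scaleOn T t * A ∉ tightOps T S := by
    refine Filter.Eventually.of_forall fun A => ?_
    by_cases hA : IsUnit A
    · have := (subsingleton_setOf_scaleOn_mul_mem_tightOps T S
        (ContinuousLinearMap.injective_of_isUnit hA)).measure_zero volume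
      filter_upwards [measure_eq_zero_iff_ae_notMem.1 this] with t ht _ using ht
    · exact Filter.Eventually.of_forall fun t hA' => absurd hA' hA
  rw [← Measure.ae_ae_comm (measurableSet_setOf_isUnit_imp_notMem (continuous_scaleOn T)
    (isClosed_tightOps T S))] at h
  obtain ⟨t, ht⟩ := h.exists
  filter_upwards [ae_mul_left_of_isUnit m (isUnit_scaleOn T (-t)) ht] with A hA hu
  have := hA ((isUnit_scaleOn T (-t)).mul hu)
  rwa [← mul_assoc, scaleOn_mul_scaleOn_neg, one_mul] at this

end Operators

/-! ### Transfer to the Grassmann manifold -/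

instance isProbabilityMeasure_orthogonalHaar (n : ℕ) : IsProbabilityMeasure (orthogonalHaar n) :=
  ⟨Measure.haarMeasure_self (K₀ := (⊤ : TopologicalSpace.PositiveCompacts _))⟩

instance isHaarMeasure_orthogonalHaar (n : ℕ) : (orthogonalHaar n).IsHaarMeasure :=
  inferInstanceAs (Measure.haarMeasure _).IsHaarMeasure

/-- The right translate is again a Haar probability measure, so uniqueness applies. -/
theorem map_mul_right_orthogonalHaar {n : ℕ} (V : Matrix.orthogonalGroup (Fin n) ℝ) :
    (orthogonalHaar n).map (· * V) = orthogonalHaar n := by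
  have : IsProbabilityMeasure ((orthogonalHaar n).map (· * V)) :=
    Measure.isProbabilityMeasure_map (continuous_mul_const V).measurable.aemeasurable
  exact Measure.isHaarMeasure_eq_of_isProbabilityMeasure _ _

namespace Grassmann

theorem isUnit_toEuclideanCLM {n : ℕ} (U : Matrix.orthogonalGroup (Fin n) ℝ) :
    IsUnit (Matrix.toEuclideanCLM (n := Fin n) (𝕜 := ℝ) U.1) :=
  ((Group.isUnit U).map (Submonoid.subtype _)).map (Matrix.toEuclideanCLM (n := Fin n) (𝕜 := ℝ))

theorem rotate_plane {n l : ℕ} (U : Matrix.orthogonalGroup (Fin n) ℝ) (ν : Grassmann n l) :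
    (rotate U ν).plane = ν.plane.map
      (Matrix.toEuclideanCLM (n := Fin n) (𝕜 := ℝ) U.1 : Rn n →ₗ[ℝ] Rn n) := rfl

/-- The orthogonal group acts transitively on the planes of a given dimension. -/
theorem exists_rotate_eq {n l : ℕ} (ν ν' : Grassmann n l) :
    ∃ U : Matrix.orthogonalGroup (Fin n) ℝ, rotate U ν = ν' := by
  let e : ν.plane ≃ₗᵢ[ℝ] ν'.plane :=
    ((stdOrthonormalBasis ℝ ν.plane).reindex (finCongr ν.finrank_plane)).equiv
      ((stdOrthonormalBasis ℝ ν'.plane).reindex (finCongr ν'.finrank_plane)) (Equiv.refl _)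
  -- An isometry between the planes extends to all of ℝⁿ, where equal dimensions make it onto.
  let L : Rn n →ₗᵢ[ℝ] Rn n := (ν'.plane.subtypeₗᵢ.comp e.toLinearIsometry).extend
  let W : Rn n ≃ₗᵢ[ℝ] Rn n := L.toLinearIsometryEquiv rfl
  let w : unitary (Rn n →L[ℝ] Rn n) := Unitary.linearIsometryEquiv.symm W
  let A := Matrix.toEuclideanCLM (n := Fin n) (𝕜 := ℝ)
  have hw : A (A.symm w.1) = w.1 := A.apply_symm_apply _
  have hmem : A.symm w.1 ∈ Matrix.orthogonalGroup (Fin n) ℝ := by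
    have := w.2
    rw [Unitary.mem_iff] at this
    refine Unitary.mem_iff.2 ?_
    constructor <;> apply EquivLike.injective A
    · rw [map_mul, map_star, hw, this.1, map_one]
    · rw [map_mul, map_star, hw, this.2, map_one]
  refine ⟨⟨_, hmem⟩, Grassmann.ext ?_⟩
  have hL : ∀ s : ν.plane, A (A.symm w.1) s = e s := fun s => by
    rw [hw]
    exact LinearIsometry.extend_apply _ s
  rw [rotate_plane]
  ext x
  constructor
  · rintro ⟨s, hs, rfl⟩
    have := hL ⟨s, hs⟩
    exact this ▸ (e ⟨s, hs⟩).2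
  · intro hx
    refine ⟨e.symm ⟨x, hx⟩, (e.symm ⟨x, hx⟩).2, ?_⟩
    have := hL (e.symm ⟨x, hx⟩)
    rw [e.apply_symm_apply] at this
    exact this

theorem isTight_rotate_iff {n l : ℕ} (T : Finset (Fin n)) (U : Matrix.orthogonalGroup (Fin n) ℝ)
    (ν : Grassmann n l) : IsTight T (rotate U ν).plane ↔
      Matrix.toEuclideanCLM (n := Fin n) (𝕜 := ℝ) U.1 ∈ tightOps T ν.plane := by
  rw [rotate_plane,
    mem_tightOps_iff_isTight (ContinuousLinearMap.injective_of_isUnit (isUnit_toEuclideanCLM U))]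

/-- The orbit map from the compact group is closed and onto, so closedness descends from matrices to
planes. -/
theorem isClosed_setOf_isTight {n l : ℕ} (h : l ≤ n) (T : Finset (Fin n)) :
    IsClosed {ν : Grassmann n l | IsTight T ν.plane} := by
  have hsurj : Function.Surjective fun U => rotate U (basePlane h) := exists_rotate_eq _
  rw [← Set.image_preimage_eq {ν : Grassmann n l | IsTight T ν.plane} hsurj]
  refine (continuous_rotate _).isClosedMap _ ?_
  simp only [Set.preimage_ofPred_eq, isTight_rotate_iff]
  exact (isClosed_tightOps T _).preimage
    ((continuous_toEuclideanCLM n).comp continuous_subtype_val)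

theorem haar_setOf_isTight {n l : ℕ} (h : l ≤ n) (T : Finset (Fin n)) :
    haar h {ν | IsTight T ν.plane} = 0 := by
  let _ : MeasurableSpace (Rn n →L[ℝ] Rn n) := borel _
  have _ : BorelSpace (Rn n →L[ℝ] Rn n) := ⟨rfl⟩
  let m : Measure (Rn n →L[ℝ] Rn n) := Measure.addHaar
  let ν₀ : Grassmann n l := basePlane h
  let A := Matrix.toEuclideanCLM (n := Fin n) (𝕜 := ℝ)
  have hae : ∀ᵐ U ∂orthogonalHaar n, ∀ᵐ B ∂m, IsUnit B → A U.1 * B ∉ tightOps T ν₀.plane := by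
    refine Filter.Eventually.of_forall fun U => ?_
    filter_upwards [ae_mul_left_of_isUnit m (isUnit_toEuclideanCLM U)
      (ae_isUnit_imp_notMem_tightOps m T ν₀.plane)] with B hB hu
    exact hB ((isUnit_toEuclideanCLM U).mul hu)
  have hcont : Continuous fun U : Matrix.orthogonalGroup (Fin n) ℝ => A U.1 :=
    (continuous_toEuclideanCLM n).comp continuous_subtype_val
  rw [Measure.ae_ae_comm (measurableSet_setOf_isUnit_imp_notMem hcont
    (isClosed_tightOps T _))] at hae
  -- The invertible operators form a nonempty open set, hence one of positive measure, so one of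
  -- them is generic.
  obtain ⟨B, hBu, hB⟩ : ∃ B, IsUnit B ∧
      ∀ᵐ U ∂orthogonalHaar n, IsUnit B → A U.1 * B ∉ tightOps T ν₀.plane := by
    have hpos : m {B | IsUnit B} ≠ 0 :=
      ((Units.isOpen (R := Rn n →L[ℝ] Rn n)).measure_pos m ⟨1, isUnit_one⟩).ne'
    exact ((frequently_ae_mem_iff.2 hpos).and_eventually hae).exists
  have hBinj := ContinuousLinearMap.injective_of_isUnit hBu
  let ν : Grassmann n l := ⟨ν₀.plane.map (B : Rn n →ₗ[ℝ] Rn n),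
    (LinearEquiv.finrank_eq (Submodule.equivMapOfInjective (B : Rn n →ₗ[ℝ] Rn n) hBinj
      ν₀.plane)).symm.trans ν₀.finrank_plane⟩
  obtain ⟨V, hV⟩ := exists_rotate_eq ν₀ ν
  have hmeas := (isClosed_setOf_isTight h T).measurableSet
  have hpre := (continuous_rotate ν₀).measurable hmeas
  -- Translating by V replaces U ν₀ by U V ν₀ = U B ν₀, to which the choice of B applies.
  rw [haar, Measure.map_apply (continuous_rotate _).measurable hmeas,
    ← map_mul_right_orthogonalHaar V, Measure.map_apply (continuous_mul_const V).measurable hpre,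
    measure_eq_zero_iff_ae_notMem]
  filter_upwards [hB] with U hU htight
  refine hU hBu ((mem_tightOps_iff_isTight
    (ContinuousLinearMap.injective_of_isUnit ((isUnit_toEuclideanCLM U).mul hBu))).2 ?_)
  have htight : IsTight T (rotate (U * V) ν₀).plane := htight
  rw [rotate_mul, hV, rotate_plane] at htight
  have hcomp : ((A U.1 * B : Rn n →L[ℝ] Rn n) : Rn n →ₗ[ℝ] Rn n) =
      (A U.1 : Rn n →ₗ[ℝ] Rn n).comp (B : Rn n →ₗ[ℝ] Rn n) := rfl
  rw [hcomp, Submodule.map_comp]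
  exact htight

end Grassmann

theorem corollary6 (n k l : ℕ) (hl : l ≤ n) (α : ℝ) (hα : 0 < α) :
    Grassmann.haar hl (ercSet (zapF α) n k l) = Grassmann.haar hl (ercSet l1F n k l) := by
  refine (measure_eq_measure_of_null_sdiff (ercSet_l1F_subset_ercSet_zapF n k l hα) ?_).symm
  refine measure_mono_null (ercSet_zapF_diff_subset n k l hα) ?_
  exact measure_iUnion_null fun T => Grassmann.haar_setOf_isTight hl T
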